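/- Let $\mathcal X,\mathcal Y$ be compact Polish spaces, $\mu,\nu$ Borel probability measures on $\mathcal X$ and $\mathcal Y$, and $c:\mathcal X\times\mathcal Y\to[0,\infty)$ a continuous cost (for example $\mathcal X,\mathcal Y\subset\mathbb R^d$ compact and $c(x,y)=\tau\|x-y\|_2^2$ with $\tau>0$). For $i=1,2$ let $\Psi_i:\mathbb R\to[0,\infty]$ be an entropy function, i.e. convex, lower semicontinuous, with $\Psi_i(x)=\infty$ for $x<0$, whose convex conjugate $\Psi_i^*(x)=\sup_{y\in\mathbb R}(xy-\Psi_i(y))$ satisfies $\Psi_i^*(0)=0$ and $(\Psi_i^*)'(0)=1$. For finite positive Borel measures $\rho,\sigma$ on the same space, with Lebesgue decomposition $\rho=\frac{d\rho}{d\sigma}\sigma+\rho^\perp$, let $$D_{\Psi}(\rho|\sigma)=\int\Psi\Big(\frac{d\rho}{d\sigma}\Big)\,d\sigma+\Psi'_\infty\,\rho^\perp(\text{whole space}),\qquad \Psi'_\infty=\lim_{x\to\infty}\frac{\Psi(x)}{x},\qquad \infty\cdot0=0,$$ be the Csiszár divergence. Let $$C(\mu,\nu)=\inf_{\pi\in\Pi(\mu,\nu)}\int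 c\,d\pi,\qquad C^\alpha_{ub}(\mu,\nu)=\inf_{\pi}\Big[\int c\,d\pi+\alpha D_{\Psi_1}(\pi_0|\mu)+\alpha D_{\Psi_2}(\pi_1|\nu)\Big],$$ where $\Pi(\mu,\nu)$ is the set of measures on $\mathcal X\times\mathcal Y$ with marginals $\mu,\nu$, and the second infimum is over all finite positive Borel measures $\pi$ on $\mathcal X\times\mathcal Y$, with marginals $\pi_0$ and $\pi_1$. A minimizer is called an optimal plan. Assume that $\Psi_1,\Psi_2$ are strictly convex and finite on $(0,\infty)$. Then $C(\mu,\nu)$ has an optimal plan, and so has $C^\alpha_{ub}(\mu,\nu)$ for every $\alpha>0$. If the optimal plan $\pi^\star$ of $C(\mu,\nu)$ is unique, then for every choice of optimal plans $\pi^{\alpha,\star}$ of $C^\alpha_{ub}(\mu,\nu)$, $\alpha>0$, one has $\pi^{\alpha,\star}\to\pi^\star$ weakly as $\alpha\to\infty$. In general, every weakly open set of finite positive Borel measures on $\mathcal X\times\mathcal Y$ that contains all optimal plans of $C(\mu,\nu)$ contains, for all sufficiently large $\alpha$, all optimal plans of $C^\alpha_{ub}(\mu,\nu)$. -/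

import Mathlib

open MeasureTheory Filter Topology Set
open scoped ENNReal NNReal

namespace UOT

/-- An entropy function `Ψ : ℝ → [0, ∞]`: convex, lower semicontinuous, and `+∞` on the negative
half-line (convexity of an extended-valued function uses convex combinations with `ℝ≥0` weights). -/
structure IsEntropyFunction (Ψ : ℝ → ℝ≥0∞) : Prop where
  convexOn : ConvexOn ℝ≥0 univ Ψ
  lowerSemicontinuous : LowerSemicontinuous Ψ
  eq_top_of_neg : ∀ x < 0, Ψ x = ⊤

/-- The convex conjugate `Ψ*(x) = sup_y (x y - Ψ(y))`. -/
noncomputable def conjugate (Ψ : ℝ → ℝ≥0∞) (x : ℝ) : EReal :=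
  ⨆ y : ℝ, ((x * y : ℝ) : EReal) - (Ψ y : EReal)

/-- The normalization `Ψ*(0) = 0`, `(Ψ*)'(0) = 1`; differentiability at `0` includes that `Ψ*` is
finite near `0`. -/
structure IsNormalized (Ψ : ℝ → ℝ≥0∞) : Prop where
  conjugate_zero : conjugate Ψ 0 = 0
  conjugate_ne_top : ∀ᶠ x in 𝓝 (0 : ℝ), conjugate Ψ x ≠ ⊤
  hasDerivAt_conjugate : HasDerivAt (fun x : ℝ => (conjugate Ψ x).toReal) 1 0

/-- The recession constant `Ψ'_∞ = lim_{x → ∞} Ψ(x) / x`. -/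
noncomputable def recession (Ψ : ℝ → ℝ≥0∞) : ℝ≥0∞ :=
  limsup (fun x : ℝ => Ψ x / ENNReal.ofReal x) atTop

/-- The Csiszár divergence `D_Ψ(ρ|μ) = ∫ Ψ(dρ/dμ) dμ + Ψ'_∞ ρ^⊥(Z)`, with `ρ = (dρ/dμ) μ + ρ^⊥`
the Lebesgue decomposition and `∞ * 0 = 0`. If `Ψ` is superlinear, it is `∞` unless `ρ ≪ μ`. -/
noncomputable def csiszarDiv {Z : Type*} [MeasurableSpace Z] (Ψ : ℝ → ℝ≥0∞) (ρ μ : Measure Z) :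
    ℝ≥0∞ :=
  ∫⁻ z, Ψ (ρ.rnDeriv μ z).toReal ∂μ + recession Ψ * ρ.singularPart μ univ

variable {X Y : Type*} [MeasurableSpace X] [MeasurableSpace Y]

/-- The transport cost `∫ c dπ` of a plan, for a non-negative cost `c`. -/
noncomputable def transportCost (c : X × Y → ℝ≥0) (π : FiniteMeasure (X × Y)) : ℝ≥0∞ :=
  ∫⁻ p, (c p : ℝ≥0∞) ∂(π : Measure (X × Y))

/-- `Π(μ, ν)`: the plans with marginals `μ` and `ν`. -/
def couplings (μ : Measure X) (ν : Measure Y) : Set (FiniteMeasure (X × Y)) :=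
  {π | (π : Measure (X × Y)).fst = μ ∧ (π : Measure (X × Y)).snd = ν}

/-- The Kantorovich value `C(μ, ν)`. -/
noncomputable def otValue (c : X × Y → ℝ≥0) (μ : Measure X) (ν : Measure Y) : ℝ≥0∞ :=
  ⨅ π ∈ couplings μ ν, transportCost c π

/-- The set of optimal plans of the Kantorovich problem. -/
def otPlans (c : X × Y → ℝ≥0) (μ : Measure X) (ν : Measure Y) : Set (FiniteMeasure (X × Y)) :=
  {π | π ∈ couplings μ ν ∧ transportCost c π = otValue c μ ν}

/-- The objective of the `α`-scaled unbalanced problem. -/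
noncomputable def uotObjective (c : X × Y → ℝ≥0) (Ψ₁ Ψ₂ : ℝ → ℝ≥0∞) (μ : Measure X)
    (ν : Measure Y) (α : ℝ) (π : FiniteMeasure (X × Y)) : ℝ≥0∞ :=
  transportCost c π + ENNReal.ofReal α * csiszarDiv Ψ₁ (π : Measure (X × Y)).fst μ
    + ENNReal.ofReal α * csiszarDiv Ψ₂ (π : Measure (X × Y)).snd ν

/-- The value `C_ub^α(μ, ν)`, an infimum over all finite positive measures on `X × Y`. -/
noncomputable def uotValue (c : X × Y → ℝ≥0) (Ψ₁ Ψ₂ : ℝ → ℝ≥0∞) (μ : Measure X)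
    (ν : Measure Y) (α : ℝ) : ℝ≥0∞ :=
  ⨅ π : FiniteMeasure (X × Y), uotObjective c Ψ₁ Ψ₂ μ ν α π

/-- The set of optimal plans of the `α`-scaled unbalanced problem. -/
def uotPlans (c : X × Y → ℝ≥0) (Ψ₁ Ψ₂ : ℝ → ℝ≥0∞) (μ : Measure X)
    (ν : Measure Y) (α : ℝ) : Set (FiniteMeasure (X × Y)) :=
  {π | uotObjective c Ψ₁ Ψ₂ μ ν α π = uotValue c Ψ₁ Ψ₂ μ ν α}

end UOT

/- The convex conjugates turn the Csiszár divergence into a supremum of weakly continuous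
functionals,
`D_Ψ(ρ|μ) = sup_φ (∫ φ dρ - ∫ Ψ*(φ) dμ)`,
over continuous `φ` with values in a compact part of the interior of the domain of `Ψ*`. Hence
`D_Ψ(·|μ)` is weakly lower semicontinuous, and constant potentials `φ > 0` show that a bound on it
bounds the mass of `ρ`. Since `(Ψ*)'(0) = 1`, the only zero of `Ψ` is `1`, so that the marginal
penalty vanishes exactly on `Π(μ, ν)`.

A plan optimal for some `α ≥ 1` satisfies `∫ c dπ + α · penalty(π) ≤ C(μ, ν)`, and by the mass bound
these inequalities confine all such plans to one weakly compact set `K`. If `U` is a weakly open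
neighbourhood of the optimal plans for `C(μ, ν)`, the open sets where
`∫ c dπ + n · penalty(π) > C(μ, ν)` increase with `n` and cover the compact set `K \ U`; one of them
therefore contains `K \ U`, and for `α ≥ n` every optimal plan lies in `U`. -/

open scoped BoundedContinuousFunction

namespace UOT

section Conjugate

variable {Ψ : ℝ → ℝ≥0∞}

/-- The effective domain of the convex conjugate `Ψ*`. -/
def conjugateDomain (Ψ : ℝ → ℝ≥0∞) : Set ℝ := {x | conjugate Ψ x ≠ ⊤}

/-- The convex conjugate `Ψ*` as a real-valued function, for use on its effective domain. -/
noncomputable def realConjugate (Ψ : ℝ → ℝ≥0∞) (x : ℝ) : ℝ := (conjugate Ψ x).toReal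

theorem conjugate_le_coe_iff {x b : ℝ} :
    conjugate Ψ x ≤ (b : EReal) ↔ ∀ y, ENNReal.ofReal (x * y - b) ≤ Ψ y := by
  refine iSup_le_iff.trans (forall_congr' fun y => ?_)
  by_cases hy : Ψ y = ⊤
  · simp [hy]
  · rw [ENNReal.ofReal_le_iff_le_toReal hy, ← EReal.coe_ennreal_toReal hy, ← EReal.coe_sub,
      EReal.coe_le_coe_iff, sub_le_comm]

theorem ofReal_mul_sub_realConjugate_le {x : ℝ} (hx : x ∈ conjugateDomain Ψ) (y : ℝ) :
    ENNReal.ofReal (x * y - realConjugate Ψ x) ≤ Ψ y :=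
  conjugate_le_coe_iff.1 (EReal.le_coe_toReal hx) y

theorem mul_sub_toReal_le_realConjugate {x y : ℝ} (hx : x ∈ conjugateDomain Ψ) (hy : Ψ y ≠ ⊤) :
    x * y - (Ψ y).toReal ≤ realConjugate Ψ x :=
  sub_le_comm.1 <|
    (ENNReal.ofReal_le_iff_le_toReal hy).1 (ofReal_mul_sub_realConjugate_le hx y)

theorem mem_conjugateDomain_of_conjugate_le {x b : ℝ} (h : conjugate Ψ x ≤ (b : EReal)) :
    x ∈ conjugateDomain Ψ :=
  ne_top_of_le_ne_top (EReal.coe_ne_top b) h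

theorem realConjugate_le {x y b : ℝ} (hy : Ψ y ≠ ⊤) (h : conjugate Ψ x ≤ (b : EReal)) :
    realConjugate Ψ x ≤ b := by
  have hbot : conjugate Ψ x ≠ ⊥ := fun hbot => by
    have hle : ((x * y : ℝ) : EReal) - (Ψ y : EReal) ≤ conjugate Ψ x :=
      le_iSup (fun y : ℝ => ((x * y : ℝ) : EReal) - (Ψ y : EReal)) y
    rw [hbot, ← EReal.coe_ennreal_toReal hy, ← EReal.coe_sub] at hle
    exact EReal.coe_ne_bot _ (le_bot_iff.1 hle)
  exact EReal.toReal_le_toReal h hbot (EReal.coe_ne_top b)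

theorem convexOn_realConjugate {y : ℝ} (hy : Ψ y ≠ ⊤) :
    ConvexOn ℝ (conjugateDomain Ψ) (realConjugate Ψ) := by
  have key : ∀ ⦃x⦄, x ∈ conjugateDomain Ψ → ∀ ⦃x'⦄, x' ∈ conjugateDomain Ψ → ∀ ⦃s t : ℝ⦄,
      0 ≤ s → 0 ≤ t → s + t = 1 → conjugate Ψ (s • x + t • x') ≤
        ((s • realConjugate Ψ x + t • realConjugate Ψ x' : ℝ) : EReal) := by
    refine fun x hx x' hx' s t hs ht hst => conjugate_le_coe_iff.2 fun z => ?_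
    by_cases hz : Ψ z = ⊤
    · simp [hz]
    rw [ENNReal.ofReal_le_iff_le_toReal hz]
    calc (s • x + t • x') * z - (s • realConjugate Ψ x + t • realConjugate Ψ x')
        = s * (x * z - realConjugate Ψ x) + t * (x' * z - realConjugate Ψ x') := by
          simp only [smul_eq_mul]; ring
      _ ≤ s * (Ψ z).toReal + t * (Ψ z).toReal := by
          gcongr <;> linarith [mul_sub_toReal_le_realConjugate hx hz,
            mul_sub_toReal_le_realConjugate hx' hz]
      _ = (Ψ z).toReal := by rw [← add_mul, hst, one_mul]
  exact ⟨fun x hx x' hx' s t hs ht hst =>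
      mem_conjugateDomain_of_conjugate_le (key hx hx' hs ht hst),
    fun x hx x' hx' s t hs ht hst => realConjugate_le hy (key hx hx' hs ht hst)⟩

theorem IsEntropyFunction.conjugate_mono (hΨ : IsEntropyFunction Ψ) : Monotone (conjugate Ψ) := by
  refine fun x x' hxx' => iSup_mono fun y => ?_
  rcases lt_or_ge y 0 with hy | hy
  · simp [hΨ.eq_top_of_neg y hy]
  · exact EReal.sub_le_sub (EReal.coe_le_coe (mul_le_mul_of_nonneg_right hxx' hy)) le_rfl

theorem IsEntropyFunction.isLowerSet_conjugateDomain (hΨ : IsEntropyFunction Ψ) :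
    IsLowerSet (conjugateDomain Ψ) :=
  fun _ _ h hx => ne_top_of_le_ne_top hx (hΨ.conjugate_mono h)

theorem IsEntropyFunction.realConjugate_le_realConjugate (hΨ : IsEntropyFunction Ψ) {x x' y : ℝ}
    (hy : Ψ y ≠ ⊤) (hx' : x' ∈ conjugateDomain Ψ) (h : x ≤ x') :
    realConjugate Ψ x ≤ realConjugate Ψ x' :=
  realConjugate_le hy ((hΨ.conjugate_mono h).trans (EReal.le_coe_toReal hx'))

theorem IsEntropyFunction.mem_interior_conjugateDomain_of_lt (hΨ : IsEntropyFunction Ψ) {x x' : ℝ}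
    (hx' : x' ∈ conjugateDomain Ψ) (h : x < x') : x ∈ interior (conjugateDomain Ψ) :=
  mem_interior.2 ⟨Iio x', fun _ hz => hΨ.isLowerSet_conjugateDomain (le_of_lt hz) hx',
    isOpen_Iio, h⟩

theorem convexOn_toReal {E : Type*} [AddCommMonoid E] [Module ℝ E] {f : E → ℝ≥0∞}
    (hf : ConvexOn ℝ≥0 univ f) : ConvexOn ℝ {z | f z ≠ ⊤} fun z => (f z).toReal := by
  have key : ∀ ⦃x⦄, f x ≠ ⊤ → ∀ ⦃y⦄, f y ≠ ⊤ → ∀ ⦃a b : ℝ⦄, 0 ≤ a → 0 ≤ b → a + b = 1 →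
      f (a • x + b • y) ≤ ENNReal.ofReal (a * (f x).toReal + b * (f y).toReal) := by
    intro x hx y hy a b ha hb hab
    refine (hf.2 (mem_univ x) (mem_univ y) (zero_le (a := (⟨a, ha⟩ : ℝ≥0)))
      (zero_le (a := (⟨b, hb⟩ : ℝ≥0))) (NNReal.eq hab)).trans_eq ?_
    rw [ENNReal.ofReal_add (by positivity) (by positivity), ENNReal.ofReal_mul ha,
      ENNReal.ofReal_mul hb, ENNReal.ofReal_toReal hx, ENNReal.ofReal_toReal hy,
      ENNReal.ofReal_eq_coe_nnreal ha, ENNReal.ofReal_eq_coe_nnreal hb]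
    rfl
  exact ⟨fun x hx y hy a b ha hb hab =>
      ne_top_of_le_ne_top ENNReal.ofReal_ne_top (key hx hy ha hb hab),
    fun x hx y hy a b ha hb hab =>
      ENNReal.toReal_le_of_le_ofReal (by positivity) (key hx hy ha hb hab)⟩

theorem isClosed_epigraph_toReal {E : Type*} [TopologicalSpace E] {f : E → ℝ≥0∞}
    (hf : LowerSemicontinuous f) : IsClosed {p : E × ℝ | f p.1 ≠ ⊤ ∧ (f p.1).toReal ≤ p.2} := by
  have hepi : {p : E × ℝ | f p.1 ≠ ⊤ ∧ (f p.1).toReal ≤ p.2} =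
      {p | f p.1 ≤ ENNReal.ofReal p.2} ∩ {p | 0 ≤ p.2} := by
    ext ⟨z, t⟩
    refine ⟨fun ⟨hz, hzt⟩ => ⟨(ENNReal.le_ofReal_iff_toReal_le hz ?_).2 hzt, ?_⟩,
      fun ⟨hzt, ht⟩ => ⟨ne_top_of_le_ne_top ENNReal.ofReal_ne_top hzt,
        ENNReal.toReal_le_of_le_ofReal ht hzt⟩⟩ <;> exact ENNReal.toReal_nonneg.trans hzt
  have hcont : Continuous fun p : E × ℝ => (p.1, ENNReal.ofReal p.2) :=
    continuous_fst.prodMk (ENNReal.continuous_ofReal.comp continuous_snd)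
  exact hepi ▸ (hf.isClosed_epigraph.preimage hcont).inter
    (isClosed_le continuous_const continuous_snd)

theorem exists_separating_epigraph_of_lt (hconv : ConvexOn ℝ≥0 univ Ψ)
    (hlsc : LowerSemicontinuous Ψ) {y₀ y : ℝ} (hy₀ : Ψ y₀ ≠ ⊤) {L : ℝ≥0} (hL : L < Ψ y) :
    ∃ α β u : ℝ, 0 ≤ β ∧ α * y + β * L < u ∧
      ∀ z, Ψ z ≠ ⊤ → u < α * z + β * (Ψ z).toReal := by
  obtain ⟨f, u, hfu, hu⟩ := geometric_hahn_banach_point_closed (x := (y, (L : ℝ)))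
    (convexOn_toReal hconv).convex_epigraph (isClosed_epigraph_toReal hlsc) fun h =>
      hL.not_ge <| by simpa using (ENNReal.le_ofReal_iff_toReal_le h.1 L.coe_nonneg).2 h.2
  have hf : ∀ z t, f (z, t) = f (1, 0) * z + f (0, 1) * t := fun z t => by
    rw [show (z, t) = z • ((1 : ℝ), (0 : ℝ)) + t • ((0 : ℝ), (1 : ℝ)) by simp, map_add, map_smul,
      map_smul, smul_eq_mul, smul_eq_mul, mul_comm z, mul_comm t]
  refine ⟨f (1, 0), f (0, 1), u, ?_, hf y L ▸ hfu, fun z hz => hf z _ ▸ hu _ ⟨hz, le_rfl⟩⟩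
  by_contra! hneg
  have hlim : Tendsto (fun t => f (1, 0) * y₀ + f (0, 1) * t) atTop atBot :=
    tendsto_const_nhds.add_atBot (tendsto_id.const_mul_atTop_of_neg hneg)
  obtain ⟨t, htu, ht⟩ :=
    ((hlim.eventually_le_atBot u).and (eventually_ge_atTop (Ψ y₀).toReal)).exists
  exact (hf y₀ t ▸ hu (y₀, t) ⟨hy₀, ht⟩).not_ge htu

/-- The non-trivial half of the Fenchel–Moreau theorem. -/
theorem exists_lt_ofReal_mul_sub_realConjugate (hconv : ConvexOn ℝ≥0 univ Ψ)
    (hlsc : LowerSemicontinuous Ψ) {y₀ y : ℝ} (hy₀ : Ψ y₀ ≠ ⊤) {L : ℝ≥0∞} (hL : L < Ψ y) :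
    ∃ x ∈ conjugateDomain Ψ, L < ENNReal.ofReal (x * y - realConjugate Ψ x) := by
  lift L to ℝ≥0 using hL.ne_top
  obtain ⟨α, β, u, hβ, hyu, hu⟩ := exists_separating_epigraph_of_lt hconv hlsc hy₀ hL
  -- Since `Ψ ≥ 0`, raising `β` keeps the epigraph on its side; this rules out vertical lines.
  obtain ⟨γ, hγu, hγ⟩ : ∃ γ, α * y + γ * L < u ∧ β < γ := by
    have hcont : Continuous fun γ : ℝ => α * y + γ * L := by fun_prop
    exact ((((hcont.tendsto β).eventually_lt_const hyu).filter_mono nhdsWithin_le_nhds).and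
      (self_mem_nhdsWithin : Ioi β ∈ 𝓝[>] β)).exists
  have hγ0 : 0 < γ := hβ.trans_lt hγ
  have hconj : conjugate Ψ (-α / γ) ≤ ((-u / γ : ℝ) : EReal) := by
    refine conjugate_le_coe_iff.2 fun z => ?_
    by_cases hz : Ψ z = ⊤
    · simp [hz]
    have hzγ : β * (Ψ z).toReal ≤ γ * (Ψ z).toReal := by gcongr
    refine ENNReal.ofReal_le_of_le_toReal ?_
    rw [div_mul_eq_mul_div, ← sub_div, div_le_iff₀ hγ0]
    linarith [hu z hz]
  refine ⟨-α / γ, mem_conjugateDomain_of_conjugate_le hconj, ?_⟩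
  rw [← ENNReal.ofReal_coe_nnreal, ENNReal.ofReal_lt_ofReal_iff_of_nonneg L.coe_nonneg]
  calc (L : ℝ) < -α / γ * y - -u / γ := by
        rw [div_mul_eq_mul_div, ← sub_div, lt_div_iff₀ hγ0]
        linarith
    _ ≤ -α / γ * y - realConjugate Ψ (-α / γ) := by gcongr; exact realConjugate_le hy₀ hconj

end Conjugate

section Normalized

variable {Ψ : ℝ → ℝ≥0∞}

theorem IsNormalized.exists_ne_top (hn : IsNormalized Ψ) : ∃ y, Ψ y ≠ ⊤ := by
  by_contra! h
  simpa [conjugate, h] using hn.conjugate_zero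

theorem IsNormalized.realConjugate_zero (hn : IsNormalized Ψ) : realConjugate Ψ 0 = 0 := by
  simp [realConjugate, hn.conjugate_zero]

theorem IsNormalized.zero_mem_interior_conjugateDomain (hn : IsNormalized Ψ) :
    (0 : ℝ) ∈ interior (conjugateDomain Ψ) :=
  mem_interior_iff_mem_nhds.2 hn.conjugate_ne_top

theorem IsNormalized.exists_pos_mem_conjugateDomain (hn : IsNormalized Ψ) :
    ∃ x ∈ conjugateDomain Ψ, 0 < x :=
  ((hn.conjugate_ne_top.filter_mono nhdsWithin_le_nhds).and
    (self_mem_nhdsWithin : Ioi (0 : ℝ) ∈ 𝓝[>] 0)).exists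

theorem IsNormalized.eq_one_of_eq_zero (hn : IsNormalized Ψ) {y : ℝ} (hy : Ψ y = 0) : y = 1 := by
  have hmin : IsLocalMin (fun x => realConjugate Ψ x - x * y) 0 := by
    filter_upwards [hn.conjugate_ne_top] with x hx
    have := mul_sub_toReal_le_realConjugate hx (hy ▸ ENNReal.zero_ne_top)
    simp only [hn.realConjugate_zero, hy, ENNReal.toReal_zero] at this ⊢
    linarith
  have hderiv := hn.hasDerivAt_conjugate.sub ((hasDerivAt_id (0 : ℝ)).mul_const y)
  linarith [hmin.hasDerivAt_eq_zero hderiv]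

/-- The graph of the convex function `Ψ*` lies above its tangent at `0`. -/
theorem IsNormalized.le_realConjugate (hn : IsNormalized Ψ) {x : ℝ}
    (hx : x ∈ conjugateDomain Ψ) : x ≤ realConjugate Ψ x := by
  obtain ⟨y, hy⟩ := hn.exists_ne_top
  have hconv := convexOn_realConjugate hy
  have h0 := interior_subset hn.zero_mem_interior_conjugateDomain
  rcases lt_trichotomy x 0 with hneg | rfl | hpos
  · have := hconv.slope_le_of_hasDerivAt hx h0 hneg hn.hasDerivAt_conjugate
    rw [slope_def_field, div_le_iff₀ (by linarith), hn.realConjugate_zero] at this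
    linarith
  · exact hn.realConjugate_zero.ge
  · have := hconv.le_slope_of_hasDerivAt h0 hx hpos hn.hasDerivAt_conjugate
    rw [slope_def_field, le_div_iff₀ (by linarith), hn.realConjugate_zero] at this
    linarith

theorem IsNormalized.apply_one (hn : IsNormalized Ψ) (hΨ : IsEntropyFunction Ψ) : Ψ 1 = 0 := by
  obtain ⟨y, hy⟩ := hn.exists_ne_top
  by_contra h
  obtain ⟨x, hx, hpos⟩ := exists_lt_ofReal_mul_sub_realConjugate hΨ.convexOn
    hΨ.lowerSemicontinuous hy (pos_iff_ne_zero.2 h)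
  linarith [ENNReal.ofReal_pos.1 hpos, hn.le_realConjugate hx]

end Normalized

section Recession

variable {Ψ : ℝ → ℝ≥0∞}

theorem ofReal_le_recession {x : ℝ} (hx : x ∈ conjugateDomain Ψ) :
    ENNReal.ofReal x ≤ recession Ψ := by
  have hlim : Tendsto (fun y => ENNReal.ofReal (x - realConjugate Ψ x / y)) atTop
      (𝓝 (ENNReal.ofReal x)) := by
    refine ENNReal.tendsto_ofReal ?_
    simpa using (tendsto_const_nhds (x := x)).sub (tendsto_id.const_div_atTop (realConjugate Ψ x))
  rw [← hlim.limsup_eq]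
  refine limsup_le_limsup ?_
  filter_upwards [eventually_gt_atTop (0 : ℝ)] with y hy
  rw [show x - realConjugate Ψ x / y = (x * y - realConjugate Ψ x) / y by field_simp,
    ENNReal.ofReal_div_of_pos hy]
  exact ENNReal.div_le_div_right (ofReal_mul_sub_realConjugate_le hx y) _

theorem IsNormalized.recession_pos (hn : IsNormalized Ψ) : 0 < recession Ψ := by
  obtain ⟨x, hx, hpos⟩ := hn.exists_pos_mem_conjugateDomain
  exact (ENNReal.ofReal_pos.2 hpos).trans_le (ofReal_le_recession hx)

theorem IsEntropyFunction.exists_lt_ofReal_of_lt_recession (hΨ : IsEntropyFunction Ψ)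
    (h1 : Ψ 1 = 0) {L : ℝ≥0∞} (hL : L < recession Ψ) :
    ∃ x ∈ conjugateDomain Ψ, L < ENNReal.ofReal x := by
  have hfreq : ∃ᶠ y : ℝ in atTop, L < Ψ y / ENNReal.ofReal y :=
    frequently_lt_of_lt_limsup (by isBoundedDefault) hL
  obtain ⟨y, hy, hy1⟩ := (hfreq.and_eventually (eventually_gt_atTop (1 : ℝ))).exists
  have hy0 : 0 < y := one_pos.trans hy1
  lift L to ℝ≥0 using hL.ne_top
  have hLy : ENNReal.ofReal (L * y) < Ψ y := by
    rw [ENNReal.ofReal_mul L.coe_nonneg, ENNReal.ofReal_coe_nnreal]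
    exact ENNReal.mul_lt_of_lt_div hy
  obtain ⟨x, hx, hxy⟩ := exists_lt_ofReal_mul_sub_realConjugate hΨ.convexOn
    hΨ.lowerSemicontinuous (h1 ▸ ENNReal.zero_ne_top) hLy
  refine ⟨x, hx, ?_⟩
  have hx1 : x ≤ realConjugate Ψ x := by
    simpa only [h1, mul_one, ENNReal.toReal_zero, sub_zero] using
      mul_sub_toReal_le_realConjugate (y := 1) hx (h1 ▸ ENNReal.zero_ne_top)
  rw [ENNReal.ofReal_lt_ofReal_iff_of_nonneg (mul_nonneg L.coe_nonneg hy0.le)] at hxy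
  rw [← ENNReal.ofReal_coe_nnreal, ENNReal.ofReal_lt_ofReal_iff_of_nonneg L.coe_nonneg]
  have : L * (y - 1) < x * (y - 1) := by nlinarith [L.coe_nonneg]
  exact lt_of_mul_lt_mul_right this (by linarith)

/-- The rational interior points of the effective domain of `Ψ*`: a countable set of slopes that
suffices to recover `Ψ` and its recession constant. -/
abbrev RatSlope (Ψ : ℝ → ℝ≥0∞) : Type := {q : ℚ // (q : ℝ) ∈ interior (conjugateDomain Ψ)}

theorem IsEntropyFunction.exists_ratSlope_btwn (hΨ : IsEntropyFunction Ψ) {x' x : ℝ}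
    (hx : x ∈ conjugateDomain Ψ) (h : x' < x) : ∃ q : RatSlope Ψ, x' < q.1 ∧ (q.1 : ℝ) < x := by
  obtain ⟨q, hxq, hqx⟩ := exists_rat_btwn h
  exact ⟨⟨q, hΨ.mem_interior_conjugateDomain_of_lt hx hqx⟩, hxq, hqx⟩

theorem IsEntropyFunction.iSup_ratSlope_ofReal_mul_sub (hΨ : IsEntropyFunction Ψ) {y₀ : ℝ}
    (hy₀ : Ψ y₀ ≠ ⊤) (y : ℝ) :
    ⨆ q : RatSlope Ψ, ENNReal.ofReal (q.1 * y - realConjugate Ψ q.1) = Ψ y := by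
  refine le_antisymm (iSup_le fun q =>
    ofReal_mul_sub_realConjugate_le (interior_subset q.2) y) (le_of_forall_lt fun L hL => ?_)
  obtain ⟨x, hx, hLx⟩ := exists_lt_ofReal_mul_sub_realConjugate hΨ.convexOn
    hΨ.lowerSemicontinuous hy₀ hL
  have hcont : Continuous fun t => ENNReal.ofReal (t * y - realConjugate Ψ x) :=
    ENNReal.continuous_ofReal.comp (by fun_prop)
  obtain ⟨x', hx'x, hx'⟩ := mem_nhdsLT_iff_exists_Ioo_subset.1 <|
    ((hcont.tendsto x).eventually_const_lt hLx).filter_mono nhdsWithin_le_nhds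
  obtain ⟨q, hx'q, hqx⟩ := hΨ.exists_ratSlope_btwn hx hx'x
  refine lt_iSup_iff.2 ⟨q, (hx' ⟨hx'q, hqx⟩).trans_le (ENNReal.ofReal_le_ofReal ?_)⟩
  gcongr
  exact hΨ.realConjugate_le_realConjugate hy₀ hx hqx.le

theorem IsEntropyFunction.iSup_ratSlope_ofReal (hΨ : IsEntropyFunction Ψ) (h1 : Ψ 1 = 0) :
    ⨆ q : RatSlope Ψ, ENNReal.ofReal q.1 = recession Ψ := by
  refine le_antisymm (iSup_le fun q => ofReal_le_recession (interior_subset q.2))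
    (le_of_forall_lt fun L hL => ?_)
  obtain ⟨x, hx, hLx⟩ := hΨ.exists_lt_ofReal_of_lt_recession h1 hL
  lift L to ℝ≥0 using hL.ne_top
  rw [← ENNReal.ofReal_coe_nnreal, ENNReal.ofReal_lt_ofReal_iff_of_nonneg L.coe_nonneg] at hLx
  obtain ⟨q, hLq, -⟩ := hΨ.exists_ratSlope_btwn hx hLx
  refine lt_iSup_iff.2 ⟨q, ?_⟩
  rwa [← ENNReal.ofReal_coe_nnreal, ENNReal.ofReal_lt_ofReal_iff_of_nonneg L.coe_nonneg]

end Recession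

section Selection

variable {Z ι : Type*} [MeasurableSpace Z] {h : ι → Z → ℝ}

theorem exists_simpleFunc_forall_le (hh : ∀ i, Measurable (h i)) {s : Finset ι} (hs : s.Nonempty) :
    ∃ κ : SimpleFunc Z ι, ∀ z, ∀ i ∈ s, h i z ≤ h (κ z) z := by
  classical
  induction hs using Finset.Nonempty.cons_induction with
  | singleton i =>
    exact ⟨SimpleFunc.const Z i, fun z j hj => by rw [Finset.mem_singleton.1 hj]; rfl⟩
  | cons i s _ _ ih =>
    obtain ⟨κ, hκ⟩ := ih
    have hmeas : MeasurableSet {z | h (κ z) z < h i z} :=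
      measurableSet_lt (κ.measurable_bind h hh) (hh i)
    refine ⟨SimpleFunc.piecewise _ hmeas (SimpleFunc.const Z i) κ, fun z j hj => ?_⟩
    rw [SimpleFunc.piecewise_apply]
    split_ifs with hz <;> rcases Finset.mem_cons.1 hj with rfl | hj
    · rfl
    · exact (hκ z j hj).trans (le_of_lt hz)
    · exact not_lt.1 hz
    · exact hκ z j hj

theorem exists_simpleFunc_lt_lintegral [Countable ι] (hh : ∀ i, Measurable (h i)) (i₀ : ι)
    {m : Measure Z} {L : ℝ≥0∞} (hL : L < ∫⁻ z, ⨆ i, ENNReal.ofReal (h i z) ∂m) :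
    ∃ κ : SimpleFunc Z ι, (∀ z, h i₀ z ≤ h (κ z) z) ∧
      L < ∫⁻ z, ENNReal.ofReal (h (κ z) z) ∂m := by
  classical
  have hmeas : ∀ s : Finset ι, Measurable fun z => ⨆ i ∈ s, ENNReal.ofReal (h i z) := fun s =>
    Measurable.biSup _ s.countable_toSet fun i _ => (hh i).ennreal_ofReal
  have hmono : Monotone fun (s : Finset ι) z => ⨆ i ∈ s, ENNReal.ofReal (h i z) :=
    fun s t hst z => biSup_mono fun i hi => hst hi
  simp_rw [iSup_eq_iSup_finset fun i => ENNReal.ofReal (h i _)] at hL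
  rw [lintegral_iSup_directed_of_measurable hmeas hmono.directed_le] at hL
  obtain ⟨s, hs⟩ := lt_iSup_iff.1 hL
  obtain ⟨κ, hκ⟩ := exists_simpleFunc_forall_le hh (s.insert_nonempty i₀)
  exact ⟨κ, fun z => hκ z i₀ (s.mem_insert_self i₀), hs.trans_le <| lintegral_mono fun z =>
    iSup₂_le fun i hi => ENNReal.ofReal_le_ofReal (hκ z i (Finset.mem_insert_of_mem hi))⟩

end Selection

section DualObjective

variable {Z : Type*} [MeasurableSpace Z] {Ψ : ℝ → ℝ≥0∞} {ρ μ : Measure Z}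

theorem ofReal_integral_le_lintegral_ofReal {f : Z → ℝ} (hf : Integrable f μ) :
    ENNReal.ofReal (∫ z, f z ∂μ) ≤ ∫⁻ z, ENNReal.ofReal (f z) ∂μ := by
  have hpos : ∫ z, f z ∂μ ≤ ∫ z, max (f z) 0 ∂μ :=
    integral_mono hf hf.pos_part fun z => le_max_left _ _
  refine (ENNReal.ofReal_le_ofReal hpos).trans_eq ?_
  rw [ofReal_integral_eq_lintegral_ofReal hf.pos_part (ae_of_all _ fun z => le_max_right _ _)]
  simp only [ENNReal.ofReal_max, ENNReal.ofReal_zero, zero_le, max_eq_left]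

/-- The objective `∫ φ dρ - ∫ Ψ*(φ) dμ` of the dual representation of `D_Ψ(ρ|μ)`. -/
noncomputable def dualObjective (Ψ : ℝ → ℝ≥0∞) (ρ μ : Measure Z) (φ : Z → ℝ) : ℝ :=
  ∫ z, φ z ∂ρ - ∫ z, realConjugate Ψ (φ z) ∂μ

open Classical in
/-- The density at `z` of the dual objective with respect to `μ + ρ^⊥`, for a potential with value
`x` at `z`. It is `x (dρ/dμ) - Ψ*(x)` on a set carrying `μ`, and `x` on its complement, which
carries `ρ^⊥`. -/
noncomputable def dualDensity (Ψ : ℝ → ℝ≥0∞) (ρ μ : Measure Z) (x : ℝ) (z : Z) : ℝ :=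
  if z ∈ (ρ.mutuallySingular_singularPart μ).nullSet then
    x * (ρ.rnDeriv μ z).toReal - realConjugate Ψ x
  else x

theorem measurable_dualDensity (x : ℝ) : Measurable (dualDensity Ψ ρ μ x) :=
  Measurable.ite (ρ.mutuallySingular_singularPart μ).measurableSet_nullSet
    (((ρ.measurable_rnDeriv μ).ennreal_toReal.const_mul x).sub_const _) measurable_const

theorem dualDensity_ae_eq (Ψ : ℝ → ℝ≥0∞) (ρ μ : Measure Z) :
    ∀ᵐ z ∂μ, ∀ x, dualDensity Ψ ρ μ x z = x * (ρ.rnDeriv μ z).toReal - realConjugate Ψ x := by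
  filter_upwards [measure_eq_zero_iff_ae_notMem.1
    (ρ.mutuallySingular_singularPart μ).measure_compl_nullSet] with z hz x
  exact if_pos (not_not.1 hz)

theorem dualDensity_ae_eq_singularPart (Ψ : ℝ → ℝ≥0∞) (ρ μ : Measure Z) :
    ∀ᵐ z ∂(ρ.singularPart μ), ∀ x, dualDensity Ψ ρ μ x z = x := by
  filter_upwards [measure_eq_zero_iff_ae_notMem.1
    (ρ.mutuallySingular_singularPart μ).measure_nullSet] with z hz x
  exact if_neg hz

theorem csiszarDiv_eq_lintegral_iSup_dualDensity (hΨ : IsEntropyFunction Ψ) (h1 : Ψ 1 = 0) :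
    csiszarDiv Ψ ρ μ =
      ∫⁻ z, ⨆ q : RatSlope Ψ, ENNReal.ofReal (dualDensity Ψ ρ μ q.1 z) ∂(μ + ρ.singularPart μ) := by
  rw [lintegral_add_measure, csiszarDiv, ← lintegral_const]
  congr 1 <;> refine lintegral_congr_ae ?_
  · filter_upwards [dualDensity_ae_eq Ψ ρ μ] with z hz
    simp_rw [hz, hΨ.iSup_ratSlope_ofReal_mul_sub (h1 ▸ ENNReal.zero_ne_top)]
  · filter_upwards [dualDensity_ae_eq_singularPart Ψ ρ μ] with z hz
    simp_rw [hz, hΨ.iSup_ratSlope_ofReal h1]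

theorem integrable_mul_rnDeriv [SigmaFinite ρ] {φ : Z → ℝ} (hφ : Integrable φ ρ) :
    Integrable (fun z => φ z * (ρ.rnDeriv μ z).toReal) μ := by
  have h : Integrable φ (μ.withDensity (ρ.rnDeriv μ)) :=
    hφ.mono_measure (Measure.withDensity_rnDeriv_le ρ μ)
  rw [integrable_withDensity_iff_integrable_smul' (Measure.measurable_rnDeriv ρ μ)
    (Measure.rnDeriv_lt_top ρ μ)] at h
  simpa only [smul_eq_mul, mul_comm] using h

theorem integral_eq_integral_singularPart_add [SigmaFinite ρ] [SigmaFinite μ] {φ : Z → ℝ}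
    (hφ : Integrable φ ρ) : ∫ z, φ z ∂ρ =
      ∫ z, φ z ∂(ρ.singularPart μ) + ∫ z, φ z * (ρ.rnDeriv μ z).toReal ∂μ := by
  conv_lhs => rw [← Measure.singularPart_add_rnDeriv ρ μ]
  rw [integral_add_measure (hφ.mono_measure (Measure.singularPart_le ρ μ))
    (hφ.mono_measure (Measure.withDensity_rnDeriv_le ρ μ)),
    integral_withDensity_eq_integral_toReal_smul (Measure.measurable_rnDeriv ρ μ)
    (Measure.rnDeriv_lt_top ρ μ)]
  simp only [smul_eq_mul, mul_comm]

section SigmaFinite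

variable [SigmaFinite ρ] {φ : Z → ℝ} (hφ : Integrable φ ρ)
  (hφμ : Integrable (fun z => realConjugate Ψ (φ z)) μ)

include hφ hφμ

theorem integrable_dualDensity :
    Integrable (fun z => dualDensity Ψ ρ μ (φ z) z) (μ + ρ.singularPart μ) := by
  refine Integrable.add_measure (((integrable_mul_rnDeriv hφ).sub hφμ).congr ?_)
    ((hφ.mono_measure (Measure.singularPart_le ρ μ)).congr ?_)
  · filter_upwards [dualDensity_ae_eq Ψ ρ μ] with z hz using (hz _).symm
  · filter_upwards [dualDensity_ae_eq_singularPart Ψ ρ μ] with z hz using (hz _).symm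

variable [SigmaFinite μ]

theorem integral_dualDensity :
    ∫ z, dualDensity Ψ ρ μ (φ z) z ∂(μ + ρ.singularPart μ) = dualObjective Ψ ρ μ φ := by
  obtain ⟨hμ, hs⟩ := integrable_add_measure.1 (integrable_dualDensity hφ hφμ)
  have hcongr : ∫ z, dualDensity Ψ ρ μ (φ z) z ∂μ =
      ∫ z, (φ z * (ρ.rnDeriv μ z).toReal - realConjugate Ψ (φ z)) ∂μ :=
    integral_congr_ae ((dualDensity_ae_eq Ψ ρ μ).mono fun z hz => hz _)
  have hcongr_s : ∫ z, dualDensity Ψ ρ μ (φ z) z ∂(ρ.singularPart μ) =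
      ∫ z, φ z ∂(ρ.singularPart μ) :=
    integral_congr_ae ((dualDensity_ae_eq_singularPart Ψ ρ μ).mono fun z hz => hz _)
  rw [integral_add_measure hμ hs, hcongr, hcongr_s, dualObjective,
    integral_eq_integral_singularPart_add hφ (μ := μ), integral_sub (integrable_mul_rnDeriv hφ) hφμ]
  ring

theorem ofReal_dualObjective_le_csiszarDiv (hdom : ∀ z, φ z ∈ conjugateDomain Ψ) :
    ENNReal.ofReal (dualObjective Ψ ρ μ φ) ≤ csiszarDiv Ψ ρ μ := by
  rw [← integral_dualDensity hφ hφμ]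
  refine (ofReal_integral_le_lintegral_ofReal (integrable_dualDensity hφ hφμ)).trans ?_
  rw [lintegral_add_measure, csiszarDiv, ← lintegral_const]
  refine add_le_add (lintegral_mono_ae ?_) (lintegral_mono_ae ?_)
  · filter_upwards [dualDensity_ae_eq Ψ ρ μ] with z hz
    exact hz (φ z) ▸ ofReal_mul_sub_realConjugate_le (hdom z) _
  · filter_upwards [dualDensity_ae_eq_singularPart Ψ ρ μ] with z hz
    exact (hz (φ z)).symm ▸ ofReal_le_recession (hdom z)

end SigmaFinite

theorem exists_simpleFunc_lt_dualObjective [IsFiniteMeasure ρ] [IsFiniteMeasure μ]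
    (hΨ : IsEntropyFunction Ψ) (hn : IsNormalized Ψ) {L : ℝ≥0∞} (hL : L < csiszarDiv Ψ ρ μ) :
    ∃ φ : SimpleFunc Z ℝ, (∀ z, φ z ∈ interior (conjugateDomain Ψ)) ∧
      L < ENNReal.ofReal (dualObjective Ψ ρ μ φ) := by
  let q₀ : RatSlope Ψ := ⟨0, Rat.cast_zero (α := ℝ) ▸ hn.zero_mem_interior_conjugateDomain⟩
  rw [csiszarDiv_eq_lintegral_iSup_dualDensity hΨ (hn.apply_one hΨ)] at hL
  obtain ⟨κ, hκ, hLκ⟩ := exists_simpleFunc_lt_lintegral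
    (fun q : RatSlope Ψ => measurable_dualDensity (q.1 : ℝ)) q₀ hL
  let φ : SimpleFunc Z ℝ := κ.map fun q => (q.1 : ℝ)
  have hφ : Integrable φ ρ := φ.integrable_of_isFiniteMeasure
  have hφμ : Integrable (fun z => realConjugate Ψ (φ z)) μ :=
    (φ.map (realConjugate Ψ)).integrable_of_isFiniteMeasure
  have hzero : ∀ z, dualDensity Ψ ρ μ q₀.1 z = 0 := fun z => by
    simp [q₀, dualDensity, hn.realConjugate_zero]
  refine ⟨φ, fun z => (κ z).2, hLκ.trans_eq ?_⟩
  rw [← integral_dualDensity hφ hφμ, ofReal_integral_eq_lintegral_ofReal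
    (integrable_dualDensity hφ hφμ) (ae_of_all _ fun z => (hzero z).symm.trans_le (hκ z))]
  rfl

end DualObjective

section Duality

variable {Z : Type*} [TopologicalSpace Z] [MeasurableSpace Z] [BorelSpace Z]
  {Ψ : ℝ → ℝ≥0∞}

theorem tendsto_integral_comp_of_isCompact {m : Measure Z} [IsFiniteMeasure m] {K : Set ℝ}
    (hK : IsCompact K) {k : ℝ → ℝ} (hk : ContinuousOn k K) {F : ℕ → Z → ℝ} {f : Z → ℝ}
    (hF : ∀ n, Continuous (F n)) (hFK : ∀ n z, F n z ∈ K) (hfK : ∀ z, f z ∈ K)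
    (hlim : ∀ᵐ z ∂m, Tendsto (fun n => F n z) atTop (𝓝 (f z))) :
    Tendsto (fun n => ∫ z, k (F n z) ∂m) atTop (𝓝 (∫ z, k (f z) ∂m)) := by
  obtain ⟨C, hC⟩ := hK.exists_bound_of_continuousOn hk
  refine tendsto_integral_of_dominated_convergence (fun _ => C)
    (fun n => (hk.comp_continuous (hF n) (hFK n)).aestronglyMeasurable) (integrable_const C)
    (fun n => ae_of_all _ fun z => hC _ (hFK n z)) ?_
  filter_upwards [hlim] with z hz
  exact (hk (f z) (hfK z)).tendsto.comp
    (tendsto_nhdsWithin_iff.2 ⟨hz, Eventually.of_forall fun n => hFK n z⟩)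

/-- The potentials admissible in the dual representation of the Csiszár divergence: continuous
functions with values in a compact subset of the interior of the effective domain of `Ψ*`. -/
def dualPotentials (Z : Type*) [TopologicalSpace Z] (Ψ : ℝ → ℝ≥0∞) : Set (Z →ᵇ ℝ) :=
  {φ | ∃ K ⊆ interior (conjugateDomain Ψ), IsCompact K ∧ ∀ z, φ z ∈ K}

theorem continuousOn_realConjugate {y : ℝ} (hy : Ψ y ≠ ⊤) :
    ContinuousOn (realConjugate Ψ) (interior (conjugateDomain Ψ)) :=
  (convexOn_realConjugate hy).continuousOn_interior

theorem integrable_realConjugate_of_mem_dualPotentials {y : ℝ} (hy : Ψ y ≠ ⊤) {φ : Z →ᵇ ℝ}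
    (hφ : φ ∈ dualPotentials Z Ψ) (μ : Measure Z) [IsFiniteMeasure μ] :
    Integrable (fun z => realConjugate Ψ (φ z)) μ := by
  obtain ⟨K, hKdom, hK, hφK⟩ := hφ
  have hcont := (continuousOn_realConjugate hy).mono hKdom
  obtain ⟨C, hC⟩ := hK.exists_bound_of_continuousOn hcont
  exact .of_bound (hcont.comp_continuous φ.continuous hφK).aestronglyMeasurable C
    (ae_of_all _ fun z => hC _ (hφK z))

section PseudoMetrizable

variable [TopologicalSpace.PseudoMetrizableSpace Z]

theorem exists_boundedContinuous_tendsto_ae {m : Measure Z} [IsFiniteMeasure m] {f : Z → ℝ}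
    (hf : Integrable f m) :
    ∃ F : ℕ → Z →ᵇ ℝ, ∀ᵐ z ∂m, Tendsto (fun n => F n z) atTop (𝓝 (f z)) := by
  have happrox : ∀ n : ℕ, ∃ g : Z →ᵇ ℝ, eLpNorm (⇑g - f) 1 m ≤ (n : ℝ≥0∞)⁻¹ := fun n => by
    obtain ⟨g, hg, -⟩ := (memLp_one_iff_integrable.2 hf).exists_boundedContinuous_eLpNorm_sub_le
      ENNReal.one_ne_top (ENNReal.inv_ne_zero.2 (ENNReal.natCast_ne_top n))
    exact ⟨g, eLpNorm_sub_comm f g 1 m ▸ hg⟩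
  choose g hg using happrox
  have hlim : Tendsto (fun n => eLpNorm (⇑(g n) - f) 1 m) atTop (𝓝 0) :=
    tendsto_of_tendsto_of_tendsto_of_le_of_le tendsto_const_nhds
      ENNReal.tendsto_inv_nat_nhds_zero (fun _ => zero_le) hg
  obtain ⟨ns, -, hns⟩ := (tendstoInMeasure_of_tendsto_eLpNorm one_ne_zero
    (fun n => (g n).continuous.aestronglyMeasurable) hf.1 hlim).exists_seq_tendsto_ae
  exact ⟨g ∘ ns, hns⟩

variable {ρ μ : Measure Z} [IsFiniteMeasure ρ] [IsFiniteMeasure μ]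

theorem exists_boundedContinuous_lt_dualObjective {a b : ℝ} (hab : a ≤ b)
    (hcont : ContinuousOn (realConjugate Ψ) (Icc a b)) {φ : Z → ℝ} (hφ : Measurable φ)
    (hφab : ∀ z, φ z ∈ Icc a b) {L : ℝ≥0∞} (hL : L < ENNReal.ofReal (dualObjective Ψ ρ μ φ)) :
    ∃ g : Z →ᵇ ℝ, (∀ z, g z ∈ Icc a b) ∧ L < ENNReal.ofReal (dualObjective Ψ ρ μ g) := by
  have hφint : Integrable φ (ρ + μ) := .of_mem_Icc a b hφ.aemeasurable (ae_of_all _ hφab)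
  obtain ⟨F, hF⟩ := exists_boundedContinuous_tendsto_ae hφint
  -- Clamping to `[a, b]` does not affect the limit.
  let G : ℕ → Z → ℝ := fun n z => projIcc a b hab (F n z)
  have hG : ∀ n, Continuous (G n) := fun n =>
    continuous_subtype_val.comp (continuous_projIcc.comp (F n).continuous)
  have hGab : ∀ n z, G n z ∈ Icc a b := fun n z => (projIcc a b hab (F n z)).2
  have hGlim : ∀ᵐ z ∂(ρ + μ), Tendsto (fun n => G n z) atTop (𝓝 (φ z)) := by
    filter_upwards [hF] with z hz
    have := ((continuous_subtype_val.comp (continuous_projIcc (h := hab))).tendsto (φ z)).comp hz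
    rwa [Function.comp_apply, projIcc_of_mem hab (hφab z)] at this
  rw [ae_add_measure_iff] at hGlim
  have hlim : Tendsto (fun n => dualObjective Ψ ρ μ (G n)) atTop (𝓝 (dualObjective Ψ ρ μ φ)) :=
    (tendsto_integral_comp_of_isCompact isCompact_Icc continuousOn_id hG hGab hφab hGlim.1).sub
      (tendsto_integral_comp_of_isCompact isCompact_Icc hcont hG hGab hφab hGlim.2)
  obtain ⟨n, hn⟩ := ((ENNReal.tendsto_ofReal hlim).eventually_const_lt hL).exists
  exact ⟨BoundedContinuousFunction.ofNormedAddCommGroup (G n) (hG n) _ fun z =>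
    abs_le_max_abs_abs (hGab n z).1 (hGab n z).2, hGab n, hn⟩

theorem exists_mem_dualPotentials_lt (hΨ : IsEntropyFunction Ψ) (hn : IsNormalized Ψ)
    {L : ℝ≥0∞} (hL : L < csiszarDiv Ψ ρ μ) :
    ∃ φ ∈ dualPotentials Z Ψ, L < ENNReal.ofReal (dualObjective Ψ ρ μ φ) := by
  obtain ⟨y, hy⟩ := hn.exists_ne_top
  obtain ⟨φ, hφdom, hLφ⟩ := exists_simpleFunc_lt_dualObjective hΨ hn hL
  have hrange : ∀ x ∈ insert 0 φ.range, x ∈ interior (conjugateDomain Ψ) :=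
    Finset.forall_mem_insert .. |>.2 ⟨hn.zero_mem_interior_conjugateDomain,
      SimpleFunc.forall_mem_range.2 hφdom⟩
  have hne : (insert 0 φ.range).Nonempty := Finset.insert_nonempty ..
  set a := (insert 0 φ.range).min' hne
  set b := (insert 0 φ.range).max' hne
  have hab : Icc a b ⊆ interior (conjugateDomain Ψ) :=
    (convexOn_realConjugate hy).1.interior.ordConnected.out (hrange _ (Finset.min'_mem _ hne))
      (hrange _ (Finset.max'_mem _ hne))
  have hφab : ∀ z, φ z ∈ Icc a b := fun z =>
    have hz := Finset.mem_insert_of_mem (φ.mem_range_self z)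
    ⟨Finset.min'_le _ _ hz, Finset.le_max' _ _ hz⟩
  obtain ⟨g, hgab, hLg⟩ := exists_boundedContinuous_lt_dualObjective (Finset.min'_le_max' _ hne)
    ((continuousOn_realConjugate hy).mono hab) φ.measurable hφab hLφ
  exact ⟨g, ⟨Icc a b, hab, isCompact_Icc, hgab⟩, hLg⟩

theorem csiszarDiv_eq_iSup_dualObjective (hΨ : IsEntropyFunction Ψ) (hn : IsNormalized Ψ) :
    csiszarDiv Ψ ρ μ =
      ⨆ φ ∈ dualPotentials Z Ψ, ENNReal.ofReal (dualObjective Ψ ρ μ φ) := by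
  obtain ⟨y, hy⟩ := hn.exists_ne_top
  refine le_antisymm (le_of_forall_lt fun L hL => ?_) (iSup₂_le fun φ hφ => ?_)
  · obtain ⟨φ, hφ, hLφ⟩ := exists_mem_dualPotentials_lt hΨ hn hL
    exact hLφ.trans_le (le_biSup (fun φ : Z →ᵇ ℝ => ENNReal.ofReal (dualObjective Ψ ρ μ φ)) hφ)
  · refine ofReal_dualObjective_le_csiszarDiv (φ.integrable ρ)
      (integrable_realConjugate_of_mem_dualPotentials hy hφ μ) fun z => ?_
    obtain ⟨K, hKdom, -, hφK⟩ := hφ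
    exact interior_subset (hKdom (hφK z))

theorem lowerSemicontinuous_csiszarDiv (hΨ : IsEntropyFunction Ψ) (hn : IsNormalized Ψ)
    (μ : Measure Z) [IsFiniteMeasure μ] :
    LowerSemicontinuous fun ρ : FiniteMeasure Z => csiszarDiv Ψ (ρ : Measure Z) μ := by
  simp_rw [csiszarDiv_eq_iSup_dualObjective hΨ hn]
  exact lowerSemicontinuous_biSup fun φ _ => (ENNReal.continuous_ofReal.comp
    ((FiniteMeasure.continuous_integral_boundedContinuousFunction φ).sub
      continuous_const)).lowerSemicontinuous

end PseudoMetrizable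

end Duality

section Divergence

variable {Z : Type*} [MeasurableSpace Z] {Ψ : ℝ → ℝ≥0∞}

theorem csiszarDiv_self (h1 : Ψ 1 = 0) (μ : Measure Z) [SigmaFinite μ] :
    csiszarDiv Ψ μ μ = 0 := by
  have hint : ∫⁻ z, Ψ (μ.rnDeriv μ z).toReal ∂μ = 0 := by
    rw [← lintegral_zero (μ := μ)]
    refine lintegral_congr_ae ?_
    filter_upwards [μ.rnDeriv_self] with z hz
    rw [hz, ENNReal.toReal_one, h1]
  rw [csiszarDiv, hint, Measure.singularPart_self, Measure.coe_zero, Pi.zero_apply, mul_zero,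
    add_zero]

theorem eq_of_csiszarDiv_eq_zero (hΨ : IsEntropyFunction Ψ) (hn : IsNormalized Ψ)
    {ρ μ : Measure Z} [SigmaFinite ρ] [SigmaFinite μ] (h : csiszarDiv Ψ ρ μ = 0) : ρ = μ := by
  obtain ⟨hint, hrec⟩ := add_eq_zero.1 h
  have hsing : ρ.singularPart μ = 0 := Measure.measure_univ_eq_zero.1 <|
    (mul_eq_zero.1 hrec).resolve_left hn.recession_pos.ne'
  have hmeas : Measurable fun z => Ψ (ρ.rnDeriv μ z).toReal :=
    hΨ.lowerSemicontinuous.measurable.comp (Measure.measurable_rnDeriv ρ μ).ennreal_toReal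
  have hrn : ρ.rnDeriv μ =ᵐ[μ] 1 := by
    filter_upwards [(lintegral_eq_zero_iff hmeas).1 hint] with z hz
    exact (ENNReal.toReal_eq_one_iff _).1 (hn.eq_one_of_eq_zero hz)
  rw [← Measure.singularPart_add_rnDeriv ρ μ, hsing, zero_add, withDensity_congr_ae hrn,
    withDensity_one]

theorem IsNormalized.exists_measure_univ_le_of_csiszarDiv_le (hn : IsNormalized Ψ) (μ : Measure Z)
    [IsFiniteMeasure μ] {C : ℝ≥0∞} (hC : C ≠ ⊤) :
    ∃ M : ℝ≥0, ∀ ρ : Measure Z, IsFiniteMeasure ρ → csiszarDiv Ψ ρ μ ≤ C → ρ univ ≤ M := by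
  obtain ⟨x, hx, hpos⟩ := hn.exists_pos_mem_conjugateDomain
  refine ⟨((C.toReal + μ.real univ * realConjugate Ψ x) / x).toNNReal, fun ρ _ hρ => ?_⟩
  have hdual : dualObjective Ψ ρ μ (fun _ => x) ≤ C.toReal :=
    (ENNReal.ofReal_le_iff_le_toReal hC).1 <| (ofReal_dualObjective_le_csiszarDiv
      (integrable_const x) (integrable_const _) fun _ => hx).trans hρ
  simp only [dualObjective, integral_const, smul_eq_mul] at hdual
  rw [← ofReal_measureReal]
  refine ENNReal.ofReal_le_ofReal ((le_div_iff₀ hpos).2 ?_)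
  linarith

end Divergence

section Penalty

variable {P : Type*} [TopologicalSpace P] {F G : P → ℝ≥0∞} {v : ℝ≥0∞}

theorem exists_forall_le_of_isCompact {f : P → ℝ≥0∞} (hf : LowerSemicontinuous f) {K : Set P}
    (hK : IsCompact K) {x₀ : P} (hfK : ∀ x, f x ≤ f x₀ → x ∈ K) : ∃ x, ∀ y, f x ≤ f y := by
  obtain ⟨x, -, hmin⟩ :=
    LowerSemicontinuousOn.exists_isMinOn ⟨x₀, hfK x₀ le_rfl⟩ hK (hf.lowerSemicontinuousOn K)
  refine ⟨x, fun y => ?_⟩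
  rcases le_total (f y) (f x₀) with hy | hy
  · exact hmin (hfK y hy)
  · exact (hmin (hfK x₀ le_rfl)).trans hy

theorem lowerSemicontinuous_add_ofReal_mul (hF : LowerSemicontinuous F)
    (hG : LowerSemicontinuous G) (α : ℝ) :
    LowerSemicontinuous fun x => F x + ENNReal.ofReal α * G x :=
  hF.add <| (ENNReal.continuous_const_mul ENNReal.ofReal_ne_top).comp_lowerSemicontinuous hG
    fun _ _ h => mul_le_mul_right h _

theorem monotone_add_ofReal_mul (a b : ℝ≥0∞) : Monotone fun α => a + ENNReal.ofReal α * b :=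
  fun _ _ h => by dsimp only; gcongr

theorem exists_nat_lt_add_ofReal_mul (hv : v ≠ ⊤) {a b : ℝ≥0∞} (h : b = 0 → v < a) :
    ∃ n : ℕ, v < a + ENNReal.ofReal n * b := by
  by_cases hb : b = 0
  · exact ⟨0, (h hb).trans_le le_self_add⟩
  · obtain ⟨n, hn⟩ := ENNReal.exists_nat_mul_gt hb hv
    exact ⟨n, ENNReal.ofReal_natCast n ▸ hn.trans_le le_add_self⟩

theorem eventually_forall_mem_of_add_ofReal_mul_le (hF : LowerSemicontinuous F)
    (hG : LowerSemicontinuous G) (hv : v ≠ ⊤) {K : Set P} (hK : IsCompact K)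
    (hGK : ∀ x, G x ≤ v → x ∈ K) {U : Set P} (hU : IsOpen U)
    (hFU : ∀ x, G x = 0 → F x ≤ v → x ∈ U) :
    ∀ᶠ α : ℝ in atTop, ∀ x, F x + ENNReal.ofReal α * G x ≤ v → x ∈ U := by
  have hopen : ∀ n : ℕ, IsOpen {x | v < F x + ENNReal.ofReal n * G x} := fun n =>
    (lowerSemicontinuous_add_ofReal_mul hF hG n).isOpen_preimage v
  have hdir : Directed (· ⊆ ·) fun n : ℕ => {x | v < F x + ENNReal.ofReal n * G x} :=
    directed_of_isDirected_le fun m n hmn x hx =>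
      lt_of_lt_of_le hx (monotone_add_ofReal_mul _ _ (Nat.cast_le.2 hmn))
  have hcover : K \ U ⊆ ⋃ n : ℕ, {x | v < F x + ENNReal.ofReal n * G x} := fun x hx =>
    mem_iUnion.2 <| exists_nat_lt_add_ofReal_mul hv fun h0 =>
      not_le.1 fun hle => hx.2 (hFU x h0 hle)
  obtain ⟨n, hn⟩ := (hK.diff hU).elim_directed_cover _ hopen hcover hdir
  filter_upwards [eventually_ge_atTop (1 : ℝ), eventually_ge_atTop (n : ℝ)] with α hα1 hαn x hx
  have hGx : G x ≤ v :=
    calc G x ≤ ENNReal.ofReal α * G x := le_mul_of_one_le_left' (ENNReal.one_le_ofReal.2 hα1)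
      _ ≤ v := le_add_self.trans hx
  by_contra hxU
  exact (hn ⟨hGK x hGx, hxU⟩).not_ge ((monotone_add_ofReal_mul _ _ hαn).trans hx)

end Penalty

section Plans

variable {X Y : Type*} [MeasurableSpace X] [MeasurableSpace Y] {μ : Measure X} {ν : Measure Y}
  {c : X × Y → ℝ≥0} {Ψ₁ Ψ₂ : ℝ → ℝ≥0∞}

theorem couplings_nonempty (μ : Measure X) [IsProbabilityMeasure μ] (ν : Measure Y)
    [IsProbabilityMeasure ν] : (couplings μ ν).Nonempty :=
  ⟨⟨μ.prod ν, inferInstance⟩, Measure.fst_prod, Measure.snd_prod⟩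

theorem mass_eq_of_mem_couplings {π : FiniteMeasure (X × Y)} (hπ : π ∈ couplings μ ν) :
    π.mass = μ univ := by
  rw [FiniteMeasure.ennreal_mass, ← Measure.fst_univ, hπ.1]

/-- The penalty `D_{Ψ₁}(π₀|μ) + D_{Ψ₂}(π₁|ν)` by which the unbalanced problem relaxes the
constraint `π ∈ Π(μ, ν)`. -/
noncomputable def marginalPenalty (Ψ₁ Ψ₂ : ℝ → ℝ≥0∞) (μ : Measure X) (ν : Measure Y)
    (π : FiniteMeasure (X × Y)) : ℝ≥0∞ :=
  csiszarDiv Ψ₁ (π : Measure (X × Y)).fst μ + csiszarDiv Ψ₂ (π : Measure (X × Y)).snd ν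

theorem uotObjective_eq (α : ℝ) (π : FiniteMeasure (X × Y)) :
    uotObjective c Ψ₁ Ψ₂ μ ν α π =
      transportCost c π + ENNReal.ofReal α * marginalPenalty Ψ₁ Ψ₂ μ ν π := by
  rw [uotObjective, marginalPenalty, mul_add, add_assoc]

theorem IsNormalized.exists_mass_le_of_marginalPenalty_le (hn₁ : IsNormalized Ψ₁)
    (Ψ₂ : ℝ → ℝ≥0∞) (μ : Measure X) [IsFiniteMeasure μ] (ν : Measure Y) {C : ℝ≥0∞} (hC : C ≠ ⊤) :
    ∃ M : ℝ≥0, ∀ π : FiniteMeasure (X × Y), marginalPenalty Ψ₁ Ψ₂ μ ν π ≤ C → π.mass ≤ M := by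
  obtain ⟨M, hM⟩ := hn₁.exists_measure_univ_le_of_csiszarDiv_le μ hC
  refine ⟨M, fun π hπ => ENNReal.coe_le_coe.1 ?_⟩
  rw [FiniteMeasure.ennreal_mass, ← Measure.fst_univ]
  exact hM _ inferInstance (le_self_add.trans hπ)

section Entropy

variable [IsFiniteMeasure μ] [IsFiniteMeasure ν] (hΨ₁ : IsEntropyFunction Ψ₁)
  (hΨ₂ : IsEntropyFunction Ψ₂) (hn₁ : IsNormalized Ψ₁) (hn₂ : IsNormalized Ψ₂)

include hΨ₁ hΨ₂ hn₁ hn₂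

theorem marginalPenalty_eq_zero_iff {π : FiniteMeasure (X × Y)} :
    marginalPenalty Ψ₁ Ψ₂ μ ν π = 0 ↔ π ∈ couplings μ ν := by
  refine add_eq_zero.trans (and_congr ⟨eq_of_csiszarDiv_eq_zero hΨ₁ hn₁, fun h => ?_⟩
    ⟨eq_of_csiszarDiv_eq_zero hΨ₂ hn₂, fun h => ?_⟩)
  · rw [h, csiszarDiv_self (hn₁.apply_one hΨ₁)]
  · rw [h, csiszarDiv_self (hn₂.apply_one hΨ₂)]

theorem uotObjective_eq_transportCost (α : ℝ) {π : FiniteMeasure (X × Y)}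
    (hπ : π ∈ couplings μ ν) : uotObjective c Ψ₁ Ψ₂ μ ν α π = transportCost c π := by
  rw [uotObjective_eq, (marginalPenalty_eq_zero_iff hΨ₁ hΨ₂ hn₁ hn₂).2 hπ, mul_zero, add_zero]

theorem uotValue_le_otValue (α : ℝ) : uotValue c Ψ₁ Ψ₂ μ ν α ≤ otValue c μ ν :=
  le_iInf₂ fun π hπ =>
    (iInf_le _ π).trans_eq (uotObjective_eq_transportCost hΨ₁ hΨ₂ hn₁ hn₂ α hπ)

end Entropy

end Plans

section Cost

variable {X Y : Type*} [TopologicalSpace X] [CompactSpace X] [MeasurableSpace X]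
  [TopologicalSpace Y] [CompactSpace Y] [MeasurableSpace Y] {c : X × Y → ℝ≥0} (hc : Continuous c)

include hc

theorem continuous_transportCost [OpensMeasurableSpace (X × Y)] :
    Continuous (transportCost c : FiniteMeasure (X × Y) → ℝ≥0∞) :=
  FiniteMeasure.continuous_lintegral_continuousMap (⟨c, hc⟩ : C(X × Y, ℝ≥0))

theorem transportCost_ne_top (π : FiniteMeasure (X × Y)) : transportCost c π ≠ ⊤ :=
  ((BoundedContinuousFunction.mkOfCompact ⟨c, hc⟩).lintegral_lt_top_of_nnreal
    (π : Measure (X × Y))).ne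

theorem otValue_ne_top (μ : Measure X) [IsProbabilityMeasure μ] (ν : Measure Y)
    [IsProbabilityMeasure ν] : otValue c μ ν ≠ ⊤ := by
  obtain ⟨π, hπ⟩ := couplings_nonempty μ ν
  exact ne_top_of_le_ne_top (transportCost_ne_top hc π) (iInf₂_le π hπ)

end Cost

section MarginalConstraint

variable {X Y : Type*} [TopologicalSpace X] [TopologicalSpace.PseudoMetrizableSpace X]
  [MeasurableSpace X] [BorelSpace X] [TopologicalSpace Y] [TopologicalSpace.PseudoMetrizableSpace Y]
  [MeasurableSpace Y] [BorelSpace Y] [OpensMeasurableSpace (X × Y)]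

theorem isClosed_couplings (μ : Measure X) [IsFiniteMeasure μ] (ν : Measure Y)
    [IsFiniteMeasure ν] : IsClosed (couplings μ ν) := by
  let μ' : FiniteMeasure X := ⟨μ, inferInstance⟩
  let ν' : FiniteMeasure Y := ⟨ν, inferInstance⟩
  have hpre : couplings μ ν = {π | π.map Prod.fst = μ'} ∩ {π | π.map Prod.snd = ν'} := by
    ext π
    change (π.map Prod.fst : Measure X) = (μ' : Measure X) ∧
      (π.map Prod.snd : Measure Y) = (ν' : Measure Y) ↔ π.map Prod.fst = μ' ∧ π.map Prod.snd = ν'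
    rw [FiniteMeasure.toMeasure_injective.eq_iff, FiniteMeasure.toMeasure_injective.eq_iff]
  rw [hpre]
  exact (isClosed_eq (FiniteMeasure.continuous_map continuous_fst) continuous_const).inter
    (isClosed_eq (FiniteMeasure.continuous_map continuous_snd) continuous_const)

theorem lowerSemicontinuous_marginalPenalty {Ψ₁ Ψ₂ : ℝ → ℝ≥0∞} (hΨ₁ : IsEntropyFunction Ψ₁)
    (hΨ₂ : IsEntropyFunction Ψ₂) (hn₁ : IsNormalized Ψ₁) (hn₂ : IsNormalized Ψ₂)
    (μ : Measure X) [IsFiniteMeasure μ] (ν : Measure Y) [IsFiniteMeasure ν] :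
    LowerSemicontinuous (marginalPenalty Ψ₁ Ψ₂ μ ν) :=
  ((lowerSemicontinuous_csiszarDiv hΨ₁ hn₁ μ).comp
    (FiniteMeasure.continuous_map continuous_fst)).add
    ((lowerSemicontinuous_csiszarDiv hΨ₂ hn₂ ν).comp
      (FiniteMeasure.continuous_map continuous_snd))

end MarginalConstraint

section OptimalPlans

variable {X Y : Type*}
  [TopologicalSpace X] [PolishSpace X] [CompactSpace X] [MeasurableSpace X] [BorelSpace X]
  [TopologicalSpace Y] [PolishSpace Y] [CompactSpace Y] [MeasurableSpace Y] [BorelSpace Y]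
  {c : X × Y → ℝ≥0} {Ψ₁ Ψ₂ : ℝ → ℝ≥0∞}

theorem isCompact_couplings (μ : Measure X) [IsFiniteMeasure μ] (ν : Measure Y)
    [IsFiniteMeasure ν] : IsCompact (couplings μ ν) := by
  refine (isCompact_setOfPred_finiteMeasure_le_of_compactSpace (X × Y)
    (μ univ).toNNReal).of_isClosed_subset (isClosed_couplings μ ν) fun π hπ => ?_
  rw [← mass_eq_of_mem_couplings hπ, ENNReal.toNNReal_coe]
  exact le_refl π.mass

variable (hc : Continuous c) (μ : Measure X) [IsProbabilityMeasure μ] (ν : Measure Y)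
  [IsProbabilityMeasure ν]

include hc

theorem otPlans_nonempty : (otPlans c μ ν).Nonempty := by
  obtain ⟨π, hπ, hmin⟩ := (isCompact_couplings μ ν).exists_isMinOn (couplings_nonempty μ ν)
    (continuous_transportCost hc).continuousOn
  exact ⟨π, hπ, le_antisymm (le_iInf₂ fun σ hσ => hmin hσ) (iInf₂_le π hπ)⟩

variable (hΨ₁ : IsEntropyFunction Ψ₁) (hΨ₂ : IsEntropyFunction Ψ₂) (hn₁ : IsNormalized Ψ₁)
  (hn₂ : IsNormalized Ψ₂)

include hΨ₁ hΨ₂ hn₁ hn₂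

theorem uotPlans_nonempty {α : ℝ} (hα : 0 < α) : (uotPlans c Ψ₁ Ψ₂ μ ν α).Nonempty := by
  obtain ⟨π₀, hπ₀⟩ := couplings_nonempty μ ν
  have hα₀ : ENNReal.ofReal α ≠ 0 := (ENNReal.ofReal_pos.2 hα).ne'
  have hfin : uotObjective c Ψ₁ Ψ₂ μ ν α π₀ ≠ ⊤ :=
    uotObjective_eq_transportCost (c := c) hΨ₁ hΨ₂ hn₁ hn₂ α hπ₀ ▸ transportCost_ne_top hc π₀
  obtain ⟨M, hM⟩ := hn₁.exists_mass_le_of_marginalPenalty_le Ψ₂ μ ν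
    (ENNReal.div_ne_top hfin hα₀)
  have hlsc : LowerSemicontinuous (uotObjective c Ψ₁ Ψ₂ μ ν α) := by
    simpa only [← uotObjective_eq] using lowerSemicontinuous_add_ofReal_mul
      (continuous_transportCost hc).lowerSemicontinuous
      (lowerSemicontinuous_marginalPenalty hΨ₁ hΨ₂ hn₁ hn₂ μ ν) α
  have hmass : ∀ σ, uotObjective c Ψ₁ Ψ₂ μ ν α σ ≤ uotObjective c Ψ₁ Ψ₂ μ ν α π₀ →
      σ.mass ≤ M := by
    refine fun σ hσ => hM σ ?_
    rw [ENNReal.le_div_iff_mul_le (.inl hα₀) (.inl ENNReal.ofReal_ne_top)]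
    calc marginalPenalty Ψ₁ Ψ₂ μ ν σ * ENNReal.ofReal α
        = ENNReal.ofReal α * marginalPenalty Ψ₁ Ψ₂ μ ν σ := mul_comm _ _
      _ ≤ uotObjective c Ψ₁ Ψ₂ μ ν α σ := uotObjective_eq (c := c) α σ ▸ le_add_self
      _ ≤ uotObjective c Ψ₁ Ψ₂ μ ν α π₀ := hσ
  obtain ⟨π, hπ⟩ := exists_forall_le_of_isCompact hlsc
    (isCompact_setOfPred_finiteMeasure_le_of_compactSpace (X × Y) M) hmass
  exact ⟨π, le_antisymm (le_iInf hπ) (iInf_le _ π)⟩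

theorem eventually_uotPlans_subset {U : Set (FiniteMeasure (X × Y))} (hU : IsOpen U)
    (hsub : otPlans c μ ν ⊆ U) : ∀ᶠ α : ℝ in atTop, uotPlans c Ψ₁ Ψ₂ μ ν α ⊆ U := by
  have hfin : otValue c μ ν ≠ ⊤ := otValue_ne_top hc μ ν
  obtain ⟨M, hM⟩ := hn₁.exists_mass_le_of_marginalPenalty_le Ψ₂ μ ν hfin
  have hoptimal : ∀ π, marginalPenalty Ψ₁ Ψ₂ μ ν π = 0 → transportCost c π ≤ otValue c μ ν →
      π ∈ U := fun π hπ hle =>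
    have hcoupling := (marginalPenalty_eq_zero_iff hΨ₁ hΨ₂ hn₁ hn₂).1 hπ
    hsub ⟨hcoupling, le_antisymm hle (iInf₂_le π hcoupling)⟩
  filter_upwards [eventually_forall_mem_of_add_ofReal_mul_le
    (continuous_transportCost hc).lowerSemicontinuous
    (lowerSemicontinuous_marginalPenalty hΨ₁ hΨ₂ hn₁ hn₂ μ ν) hfin
    (isCompact_setOfPred_finiteMeasure_le_of_compactSpace (X × Y) M) hM hU hoptimal] with α hα π hπ
  exact hα π <| (uotObjective_eq α π).symm.trans_le <|
    hπ.trans_le (uotValue_le_otValue hΨ₁ hΨ₂ hn₁ hn₂ α)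

theorem tendsto_of_otPlans_eq_singleton {πα : ℝ → FiniteMeasure (X × Y)}
    {πstar : FiniteMeasure (X × Y)} (hπα : ∀ α : ℝ, 0 < α → πα α ∈ uotPlans c Ψ₁ Ψ₂ μ ν α)
    (hstar : otPlans c μ ν = {πstar}) : Tendsto πα atTop (𝓝 πstar) := by
  refine tendsto_nhds.2 fun U hU hmem => ?_
  have hsub : otPlans c μ ν ⊆ U := hstar ▸ singleton_subset_iff.2 hmem
  filter_upwards [eventually_uotPlans_subset hc μ ν hΨ₁ hΨ₂ hn₁ hn₂ hU hsub,
    eventually_gt_atTop (0 : ℝ)] with α hα hα0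
  exact hα (hπα α hα0)

end OptimalPlans

end UOT

theorem theorem2_general {X Y : Type*}
    [TopologicalSpace X] [PolishSpace X] [CompactSpace X] [MeasurableSpace X] [BorelSpace X]
    [TopologicalSpace Y] [PolishSpace Y] [CompactSpace Y] [MeasurableSpace Y] [BorelSpace Y]
    (μ : Measure X) [IsProbabilityMeasure μ] (ν : Measure Y) [IsProbabilityMeasure ν]
    (c : X × Y → ℝ≥0) (hc : Continuous c)
    (Ψ₁ Ψ₂ : ℝ → ℝ≥0∞)
    (hΨ₁ : UOT.IsEntropyFunction Ψ₁) (hΨ₂ : UOT.IsEntropyFunction Ψ₂)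
    (hn₁ : UOT.IsNormalized Ψ₁) (hn₂ : UOT.IsNormalized Ψ₂) :
    (UOT.otPlans c μ ν).Nonempty ∧
    (∀ α : ℝ, 0 < α → (UOT.uotPlans c Ψ₁ Ψ₂ μ ν α).Nonempty) ∧
    (∀ (πα : ℝ → FiniteMeasure (X × Y)) (πstar : FiniteMeasure (X × Y)),
      (∀ α : ℝ, 0 < α → πα α ∈ UOT.uotPlans c Ψ₁ Ψ₂ μ ν α) →
      UOT.otPlans c μ ν = {πstar} →
      Tendsto πα atTop (𝓝 πstar)) ∧
    (∀ U : Set (FiniteMeasure (X × Y)), IsOpen U → UOT.otPlans c μ ν ⊆ U →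
      ∀ᶠ α : ℝ in atTop, UOT.uotPlans c Ψ₁ Ψ₂ μ ν α ⊆ U) :=
  ⟨UOT.otPlans_nonempty hc μ ν,
    fun _ hα => UOT.uotPlans_nonempty hc μ ν hΨ₁ hΨ₂ hn₁ hn₂ hα,
    fun _ _ hπα hstar => UOT.tendsto_of_otPlans_eq_singleton hc μ ν hΨ₁ hΨ₂ hn₁ hn₂ hπα hstar,
    fun _ hU hsub => UOT.eventually_uotPlans_subset hc μ ν hΨ₁ hΨ₂ hn₁ hn₂ hU hsub⟩

theorem theorem2 {X Y : Type*}
    [TopologicalSpace X] [PolishSpace X] [CompactSpace X] [MeasurableSpace X] [BorelSpace X]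
    [TopologicalSpace Y] [PolishSpace Y] [CompactSpace Y] [MeasurableSpace Y] [BorelSpace Y]
    (μ : Measure X) [IsProbabilityMeasure μ] (ν : Measure Y) [IsProbabilityMeasure ν]
    (c : X × Y → ℝ≥0) (hc : Continuous c)
    (Ψ₁ Ψ₂ : ℝ → ℝ≥0∞)
    (hΨ₁ : UOT.IsEntropyFunction Ψ₁) (hΨ₂ : UOT.IsEntropyFunction Ψ₂)
    (hn₁ : UOT.IsNormalized Ψ₁) (hn₂ : UOT.IsNormalized Ψ₂)
    (hs₁ : StrictConvexOn ℝ≥0 (Ioi (0 : ℝ)) Ψ₁) (hs₂ : StrictConvexOn ℝ≥0 (Ioi (0 : ℝ)) Ψ₂)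
    (hf₁ : ∀ x ∈ Ioi (0 : ℝ), Ψ₁ x ≠ ⊤) (hf₂ : ∀ x ∈ Ioi (0 : ℝ), Ψ₂ x ≠ ⊤) :
    -- optimal plans exist
    (UOT.otPlans c μ ν).Nonempty ∧
    (∀ α : ℝ, 0 < α → (UOT.uotPlans c Ψ₁ Ψ₂ μ ν α).Nonempty) ∧
    -- weak convergence to the optimal plan
    (∀ (πα : ℝ → FiniteMeasure (X × Y)) (πstar : FiniteMeasure (X × Y)),
      (∀ α : ℝ, 0 < α → πα α ∈ UOT.uotPlans c Ψ₁ Ψ₂ μ ν α) →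
      UOT.otPlans c μ ν = {πstar} →
      Tendsto πα atTop (𝓝 πstar)) ∧
    -- without uniqueness: weak convergence to the set of optimal plans
    (∀ U : Set (FiniteMeasure (X × Y)), IsOpen U → UOT.otPlans c μ ν ⊆ U →
      ∀ᶠ α : ℝ in atTop, UOT.uotPlans c Ψ₁ Ψ₂ μ ν α ⊆ U) :=
  theorem2_general μ ν c hc Ψ₁ Ψ₂ hΨ₁ hΨ₂ hn₁ hn₂
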